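/- Let $(\mathcal V,\mathcal E)$ be a strongly connected directed graph with $n\ge 1$ nodes and $m$ links (self-loops included), where $(j,i)\in\mathcal E$ means that node $j$ can receive from node $i$ and $(j,j)\in\mathcal E$ for all $j$. Let $D_j=|\{l:(l,j)\in\mathcal E\}|$ be the out-degree of $j$, let $D_{\max}=\max_j D_j$, and put $C=\dfrac{n}{(n+m)\,D_{\max}^{\,n-1}}$. Let $0<q\le 1$ and let $x_{ji}[k]$, for $(j,i)\in\mathcal E$ and $k=0,1,2,\dots$, be independent random variables with $\Pr\{x_{ji}[k]=1\}=q$ and $\Pr\{x_{ji}[k]=0\}=1-q$ (packet from $i$ to $j$ delivered, respectively dropped, at time $k$). Given initial values $y_j[0]\in\mathbb R$, $j\in\mathcal V$, define for $k\ge 0$ and $(j,i)\in\mathcal E$ $$\mu_{ji}[k]=\mu_{ji}[k-1]+\tfrac1{D_i}\,y_i[k],\qquad \nu_{ji}[k]=\mu_{ji}[k]\,x_{ji}[k]+\nu_{ji}[k-1]\,(1-x_{ji}[k]),$$ $$y_j[k+1]=\sum_{i:(j,i)\in\mathcal E}\big(\nu_{ji}[k]-\nu_{ji}[k-1]\big),\qquad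 \mu_{ji}[-1]=\nu_{ji}[-1]=0.$$ Let $z_j[k]$ be defined by the same recursion, driven by the same variables $x_{ji}[k]$, from initial values $z_j[0]>0$. Theorem. (1) Almost surely, for every node $j$, every $c>0$ (in particular $c=C$) and every strictly increasing sequence $t_1<t_2<\cdots$ of time steps with $z_j[t_r]>c$ for all $r$, $$\lim_{r\to\infty}\frac{y_j[t_r]}{z_j[t_r]}=\frac{\sum_{i}y_i[0]}{\sum_{i}z_i[0]}.$$ When $\sum_i y_i[0]\ne0$, this limit is $1/\alpha$ with $\alpha=\sum_i z_i[0]/\sum_i y_i[0]$. (2) Almost surely, for every node $j$, there are infinitely many $k$ with $z_j[k]>\frac{1}{n}\big(\sum_i z_i[0]\big)\,C$. (3) In particular, for average consensus, that is, if $z_i[0]=1$ for all $i$: almost surely, for every node $j$, $z_j[k]>C$ for infinitely many $k$, and along every strictly increasing sequence $t_1<t_2<\cdots$ of time steps with $z_j[t_r]>C$ the ratio $y_j[t_r]/z_j[t_r]$ converges to the average $\frac1n\sum_i y_i[0]$. -/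

import Mathlib

open Filter Topology MeasureTheory ProbabilityTheory

/-! Robust double iteration over an unreliable directed network.  The node set is a finite type `V`,
and `(j, i) ∈ E` means that node `j` can receive information from node `i`. -/

namespace RatioConsensus

variable {V : Type*} [Fintype V] [DecidableEq V]

/-- Every node can be reached from every node along the links in `E`. -/
def StronglyConnected (E : Finset (V × V)) : Prop :=
  ∀ i j : V, Relation.ReflTransGen (fun a b => (b, a) ∈ E) i j

/-- The out-degree of `j`: the number of nodes `l` that can receive from `j` (a self-loop counts). -/
def outDegree (E : Finset (V × V)) (j : V) : ℕ :=
  (Finset.univ.filter fun l => (l, j) ∈ E).card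

/-- The largest out-degree in the network. -/
def maxOutDegree (E : Finset (V × V)) : ℕ :=
  Finset.univ.sup (outDegree E)

/-- The constant `C = n / ((n + m) * D ^ (n - 1))`, where `n` is the number of nodes, `m` the number
of links, and `D` the largest out-degree. -/
noncomputable def massConstant (E : Finset (V × V)) : ℝ :=
  (Fintype.card V : ℝ) /
    (((Fintype.card V : ℝ) + (E.card : ℝ)) * (maxOutDegree E : ℝ) ^ (Fintype.card V - 1))

/-- The variables of one iteration at time `k`: the internal states at time `k`, and the totals of
broadcast and received mass up to time `k - 1`. -/
structure State (V : Type*) where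
  /-- the internal state of node `j` at time `k` -/
  value : V → ℝ
  /-- `sent l j`: the total mass broadcast by node `j` towards node `l` up to time `k - 1` -/
  sent : V → V → ℝ
  /-- `received j i`: the total mass received by node `j` from node `i` up to time `k - 1` -/
  received : V → V → ℝ

/-- Total broadcast mass up to time `k`. -/
noncomputable def newSent (E : Finset (V × V)) (s : State V) (l j : V) : ℝ :=
  if (l, j) ∈ E then s.sent l j + 1 / (outDegree E j : ℝ) * s.value j else 0

/-- Total received mass up to time `k`, where `x j i` indicates whether the packet from `i` to `j`
arrives at time `k`. -/
noncomputable def newReceived (E : Finset (V × V)) (x : V → V → ℝ) (s : State V) (j i : V) : ℝ :=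
  if (j, i) ∈ E then newSent E s j i * x j i + s.received j i * (1 - x j i) else 0

/-- One time step of the iteration. -/
noncomputable def step (E : Finset (V × V)) (x : V → V → ℝ) (s : State V) : State V where
  value j := ∑ i, (newReceived E x s j i - s.received j i)
  sent := newSent E s
  received := newReceived E x s

/-- All variables at time `k`, for initial internal states `u₀` and link indicators
`x k j i` at time `k`; all the running totals are zero before time `0`. -/
noncomputable def state (E : Finset (V × V)) (x : ℕ → V → V → ℝ) (u₀ : V → ℝ) : ℕ → State V
  | 0 => { value := u₀, sent := fun _ _ => 0, received := fun _ _ => 0 }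
  | k + 1 => step E (x k) (state E x u₀ k)

/-- The internal state of node `j` at time `k`. -/
noncomputable def nodeValue (E : Finset (V × V)) (x : ℕ → V → V → ℝ) (u₀ : V → ℝ)
    (k : ℕ) (j : V) : ℝ :=
  (state E x u₀ k).value j

end RatioConsensus

set_option linter.unusedSectionVars false

namespace RatioConsensus

variable {V : Type*} [Fintype V] [DecidableEq V]

/-! ### The network as a positive linear system of nodes and link buffers -/

/-! Give each link a buffer holding what was sent on it but not yet received. On nodes and buffers
together one time step is then a positive linear map that conserves total mass
(`totalMass_transfer`), so it never increases the ℓ¹ norm.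

If all packets arrive during `n` consecutive steps, the first step empties the buffers and the other
`n - 1` carry mass to a given node from everywhere, so each node ends with at least the fraction `1
/ D ^ (n - 1)` of the total, `D` being the largest out-degree (`totalMass_div_le_deliver_pow`). Such
a block contracts the ℓ¹ norm of distributions of total mass zero (`totalMass_abs_map_le`). By the
second Borel–Cantelli lemma it occurs infinitely often almost surely
(`ae_frequently_deliveredBlock`).

With `Y`, `Z` the initial sums, `Z • y - Y • z` has total mass zero, hence tends to zero, and
dividing by `z > c` gives the ratio limit (`tendsto_ratio`). The lower bound at the end of each
block gives the infinitely many times at which `z` is large (`infinite_massConstant_lt`). -/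

/-- A distribution of mass over the nodes and the link buffers. -/
abbrev Mass (V : Type*) : Type _ := (V → ℝ) × (V × V → ℝ)

/-- The mass waiting on the link `e` just before the delivery attempt. -/
noncomputable def pending (E : Finset (V × V)) (m : Mass V) (e : V × V) : ℝ :=
  m.2 e + m.1 e.2 / (outDegree E e.2 : ℝ)

/-- One time step, as a linear map on mass distributions. -/
noncomputable def transfer (E : Finset (V × V)) (x : V → V → ℝ) : Mass V →ₗ[ℝ] Mass V where
  toFun m := (fun j => ∑ i, if (j, i) ∈ E then pending E m (j, i) * x j i else 0,
    fun e => if e ∈ E then pending E m e * (1 - x e.1 e.2) else 0)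
  map_add' m m' := by
    ext j
    · simp only [Prod.fst_add, Pi.add_apply, ← Finset.sum_add_distrib]
      refine Finset.sum_congr rfl fun i _ => ?_
      split_ifs
      · simp only [pending, Prod.fst_add, Prod.snd_add, Pi.add_apply]; ring
      · simp
    · simp only [Prod.snd_add, Pi.add_apply]
      split_ifs
      · simp only [pending, Prod.fst_add, Prod.snd_add, Pi.add_apply]; ring
      · simp
  map_smul' c m := by
    ext j
    · simp only [Prod.smul_fst, Pi.smul_apply, smul_eq_mul, RingHom.id_apply, Finset.mul_sum]
      refine Finset.sum_congr rfl fun i _ => ?_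
      split_ifs
      · simp only [pending, Prod.smul_fst, Prod.smul_snd, Pi.smul_apply, smul_eq_mul]; ring
      · simp
    · simp only [Prod.smul_snd, Pi.smul_apply, smul_eq_mul, RingHom.id_apply]
      split_ifs
      · simp only [pending, Prod.smul_fst, Prod.smul_snd, Pi.smul_apply, smul_eq_mul]; ring
      · simp

lemma transfer_fst (E : Finset (V × V)) (x : V → V → ℝ) (m : Mass V) (j : V) :
    (transfer E x m).1 j = ∑ i, if (j, i) ∈ E then pending E m (j, i) * x j i else 0 := rfl

lemma transfer_snd (E : Finset (V × V)) (x : V → V → ℝ) (m : Mass V) (e : V × V) :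
    (transfer E x m).2 e = if e ∈ E then pending E m e * (1 - x e.1 e.2) else 0 := rfl

lemma transfer_congr {E : Finset (V × V)} {x x' : V → V → ℝ}
    (h : ∀ j i, (j, i) ∈ E → x j i = x' j i) : transfer E x = transfer E x' := by
  refine LinearMap.ext fun m => ?_
  ext e
  · simp only [transfer_fst]
    refine Finset.sum_congr rfl fun i _ => ?_
    split_ifs with he
    · rw [h _ _ he]
    · rfl
  · simp only [transfer_snd]
    split_ifs with he
    · rw [h _ _ he]
    · rfl

/-- The total mass in the network. -/
noncomputable def totalMass (E : Finset (V × V)) : Mass V →ₗ[ℝ] ℝ where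
  toFun m := ∑ j, m.1 j + ∑ e ∈ E, m.2 e
  map_add' m m' := by
    simp only [Prod.fst_add, Prod.snd_add, Pi.add_apply, Finset.sum_add_distrib]; ring
  map_smul' c m := by
    simp only [Prod.smul_fst, Prod.smul_snd, Pi.smul_apply, smul_eq_mul, RingHom.id_apply,
      ← Finset.mul_sum]
    ring

lemma totalMass_apply (E : Finset (V × V)) (m : Mass V) :
    totalMass E m = ∑ j, m.1 j + ∑ e ∈ E, m.2 e := rfl

lemma sum_sum_ite_mem (E : Finset (V × V)) (f : V × V → ℝ) :
    ∑ j, ∑ i, (if (j, i) ∈ E then f (j, i) else 0) = ∑ e ∈ E, f e := by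
  rw [← Fintype.sum_prod_type' (f := fun j i => if (j, i) ∈ E then f (j, i) else 0)]
  simp

lemma outDegree_pos {E : Finset (V × V)} (hself : ∀ j : V, (j, j) ∈ E) (j : V) :
    0 < outDegree E j :=
  Finset.card_pos.mpr ⟨j, by simp [hself j]⟩

/-- Each node splits its mass equally over its outgoing links; self-loops keep the divisor nonzero.
-/
lemma sum_div_outDegree {E : Finset (V × V)} (hself : ∀ j : V, (j, j) ∈ E) (v : V → ℝ) :
    ∑ e ∈ E, v e.2 / (outDegree E e.2 : ℝ) = ∑ i, v i := by
  rw [← sum_sum_ite_mem E (fun e => v e.2 / (outDegree E e.2 : ℝ)), Finset.sum_comm]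
  refine Finset.sum_congr rfl fun i _ => ?_
  have h : (outDegree E i : ℝ) ≠ 0 := by exact_mod_cast (outDegree_pos hself i).ne'
  rw [← Finset.sum_filter]
  dsimp only
  rw [Finset.sum_const, nsmul_eq_mul]
  change (outDegree E i : ℝ) * _ = _
  field_simp

lemma totalMass_transfer {E : Finset (V × V)} (hself : ∀ j : V, (j, j) ∈ E)
    (x : V → V → ℝ) (m : Mass V) : totalMass E (transfer E x m) = totalMass E m := by
  have h1 : ∑ j, (transfer E x m).1 j = ∑ e ∈ E, pending E m e * x e.1 e.2 :=
    sum_sum_ite_mem E fun e => pending E m e * x e.1 e.2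
  have h2 : ∑ e ∈ E, (transfer E x m).2 e = ∑ e ∈ E, pending E m e * (1 - x e.1 e.2) :=
    Finset.sum_congr rfl fun e he => by rw [transfer_snd, if_pos he]
  rw [totalMass_apply, totalMass_apply, h1, h2, ← Finset.sum_add_distrib,
    ← sum_div_outDegree hself m.1, ← Finset.sum_add_distrib]
  refine Finset.sum_congr rfl fun e _ => ?_
  simp only [pending]; ring

lemma pending_nonneg (E : Finset (V × V)) {m : Mass V} (hm : 0 ≤ m) (e : V × V) :
    0 ≤ pending E m e :=
  add_nonneg (hm.2 e) (div_nonneg (hm.1 e.2) (Nat.cast_nonneg _))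

lemma transfer_nonneg {E : Finset (V × V)} {x : V → V → ℝ}
    (hx : ∀ j i, (j, i) ∈ E → 0 ≤ x j i ∧ x j i ≤ 1) {m : Mass V} (hm : 0 ≤ m) :
    0 ≤ transfer E x m := by
  refine ⟨fun j => ?_, fun e => ?_⟩
  · rw [transfer_fst]
    refine Finset.sum_nonneg fun i _ => ?_
    split_ifs with h
    · exact mul_nonneg (pending_nonneg E hm _) (hx _ _ h).1
    · exact le_rfl
  · rw [transfer_snd]
    split_ifs with h
    · exact mul_nonneg (pending_nonneg E hm _) (sub_nonneg.mpr (hx _ _ h).2)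
    · exact le_rfl

lemma totalMass_nonneg (E : Finset (V × V)) {m : Mass V} (hm : 0 ≤ m) : 0 ≤ totalMass E m :=
  add_nonneg (Finset.sum_nonneg fun j _ => hm.1 j) (Finset.sum_nonneg fun e _ => hm.2 e)

lemma totalMass_mono (E : Finset (V × V)) {m m' : Mass V} (h : m ≤ m') :
    totalMass E m ≤ totalMass E m' := by
  have := totalMass_nonneg E (sub_nonneg.mpr h)
  rw [map_sub] at this
  linarith

lemma abs_fst_le_totalMass (E : Finset (V × V)) (m : Mass V) (j : V) :
    |m.1 j| ≤ totalMass E |m| := by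
  have h1 : |m.1 j| ≤ ∑ i, |m.1 i| :=
    Finset.single_le_sum (f := fun i => |m.1 i|) (fun i _ => abs_nonneg _) (Finset.mem_univ j)
  have h2 : 0 ≤ ∑ e ∈ E, |m.2 e| := Finset.sum_nonneg fun e _ => abs_nonneg _
  exact h1.trans (le_add_of_nonneg_right h2)

lemma abs_map_le {T : Mass V →ₗ[ℝ] Mass V} (hT : ∀ m, 0 ≤ m → 0 ≤ T m) (m : Mass V) :
    |T m| ≤ T |m| := by
  have hmono : ∀ a b : Mass V, a ≤ b → T a ≤ T b := fun a b h => by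
    have := hT _ (sub_nonneg.mpr h)
    rwa [map_sub, sub_nonneg] at this
  refine abs_le'.mpr ⟨hmono _ _ (le_abs_self m), ?_⟩
  rw [← map_neg]
  exact hmono _ _ (neg_le_abs m)

lemma totalMass_abs_transfer_le {E : Finset (V × V)} (hself : ∀ j : V, (j, j) ∈ E)
    {x : V → V → ℝ} (hx : ∀ j i, (j, i) ∈ E → 0 ≤ x j i ∧ x j i ≤ 1) (m : Mass V) :
    totalMass E |transfer E x m| ≤ totalMass E |m| := by
  rw [← totalMass_transfer hself x |m|]
  exact totalMass_mono E (abs_map_le (fun _ h => transfer_nonneg hx h) m)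

/-- A positive mass-preserving map that sends a fraction `δ` of all mass to one node contracts
distributions of total mass zero. -/
lemma totalMass_abs_map_le {E : Finset (V × V)} {T : Mass V →ₗ[ℝ] Mass V}
    (hT : ∀ m, 0 ≤ m → 0 ≤ T m) (hmass : ∀ m, totalMass E (T m) = totalMass E m)
    {δ : ℝ} {j : V} (hδ : ∀ m, 0 ≤ m → δ * totalMass E m ≤ (T m).1 j)
    {m : Mass V} (hm : totalMass E m = 0) :
    totalMass E |T m| ≤ (1 - δ) * totalMass E |m| := by
  set a := T m⁺
  set b := T m⁻
  have hab : T m = a - b := by rw [← map_sub, posPart_sub_negPart]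
  have habs : totalMass E |m| = totalMass E m⁺ + totalMass E m⁻ := by
    rw [← posPart_add_negPart, map_add]
  have heq : totalMass E m⁺ = totalMass E m⁻ := by
    rw [← posPart_sub_negPart m, map_sub] at hm; linarith
  have ha : 0 ≤ a := hT _ (posPart_nonneg m)
  have hb : 0 ≤ b := hT _ (negPart_nonneg m)
  have haj : δ * totalMass E m⁺ ≤ a.1 j := hδ _ (posPart_nonneg m)
  have hbj : δ * totalMass E m⁻ ≤ b.1 j := hδ _ (negPart_nonneg m)
  set s := δ * totalMass E m⁺ with hs
  rw [← heq] at hbj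
  -- Both `a` and `b` carry at least `s` at node `j`, and this common part cancels in the
  -- difference.
  have key : |a - b| ≤ a + b - ((Pi.single j (2 * s), 0) : Mass V) := by
    refine ⟨fun i => ?_, fun e => ?_⟩
    · change |a.1 i - b.1 i| ≤ a.1 i + b.1 i - (Pi.single j (2 * s) : V → ℝ) i
      have h1 := ha.1 i
      have h2 := hb.1 i
      simp only [Prod.fst_zero, Pi.zero_apply] at h1 h2
      rcases eq_or_ne i j with rfl | hij
      · rw [Pi.single_eq_same, abs_le]
        constructor <;> linarith
      · rw [Pi.single_eq_of_ne hij, abs_le]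
        constructor <;> linarith
    · change |a.2 e - b.2 e| ≤ a.2 e + b.2 e - 0
      have h1 := ha.2 e
      have h2 := hb.2 e
      simp only [Prod.snd_zero, Pi.zero_apply] at h1 h2
      rw [abs_le]
      constructor <;> linarith
  have h := totalMass_mono E key
  have hsingle : totalMass E ((Pi.single j (2 * s), 0) : Mass V) = 2 * s := by
    simp [totalMass_apply]
  rw [map_sub, map_add, hsingle, hmass, hmass] at h
  rw [hab, habs]
  refine h.trans (le_of_eq ?_)
  rw [hs, ← heq]; ring

/-! ### Blocks of successful transmissions -/

/-- The nodes from which `j` can be reached in exactly `k` steps. -/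
def reachingSet (E : Finset (V × V)) (j : V) : ℕ → Finset V
  | 0 => {j}
  | k + 1 => Finset.univ.filter fun i => ∃ l ∈ reachingSet E j k, (l, i) ∈ E

lemma mem_reachingSet_succ {E : Finset (V × V)} {j i : V} {k : ℕ} :
    i ∈ reachingSet E j (k + 1) ↔ ∃ l ∈ reachingSet E j k, (l, i) ∈ E := by
  simp [reachingSet]

lemma reachingSet_subset_succ {E : Finset (V × V)} (hself : ∀ j : V, (j, j) ∈ E) (j : V) (k : ℕ) :
    reachingSet E j k ⊆ reachingSet E j (k + 1) :=
  fun i hi => mem_reachingSet_succ.mpr ⟨i, hi, hself i⟩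

lemma mem_reachingSet_self {E : Finset (V × V)} (hself : ∀ j : V, (j, j) ∈ E) (j : V) (k : ℕ) :
    j ∈ reachingSet E j k := by
  induction k with
  | zero => simp [reachingSet]
  | succ k ih => exact reachingSet_subset_succ hself j k ih

/-- A set that has stopped growing is closed under in-neighbours, so a path from any node to `j` can
be traced backwards inside it. -/
lemma eq_univ_of_reachingSet_succ_eq {E : Finset (V × V)} (hself : ∀ j : V, (j, j) ∈ E)
    (hconn : StronglyConnected E) {j : V} {k : ℕ}
    (h : reachingSet E j (k + 1) = reachingSet E j k) : reachingSet E j k = Finset.univ := by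
  refine Finset.eq_univ_of_forall fun i => ?_
  refine Relation.ReflTransGen.head_induction_on (motive := fun a _ => a ∈ reachingSet E j k)
    (hconn i j) (mem_reachingSet_self hself j k) ?_
  intro a c hac _ hc
  rw [← h]
  exact mem_reachingSet_succ.mpr ⟨c, hc, hac⟩

lemma reachingSet_card {E : Finset (V × V)} (hself : ∀ j : V, (j, j) ∈ E)
    (hconn : StronglyConnected E) (j : V) (k : ℕ) :
    reachingSet E j k = Finset.univ ∨ k + 1 ≤ (reachingSet E j k).card := by
  induction k with
  | zero => right; simp [reachingSet]
  | succ k ih =>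
    rcases ih with h | h
    · left
      exact Finset.univ_subset_iff.mp (h ▸ reachingSet_subset_succ hself j k)
    · by_cases heq : reachingSet E j (k + 1) = reachingSet E j k
      · left
        rw [heq, eq_univ_of_reachingSet_succ_eq hself hconn heq]
      · right
        have := Finset.card_lt_card
          ((reachingSet_subset_succ hself j k).ssubset_of_ne (Ne.symm heq))
        omega

lemma reachingSet_eq_univ [Nonempty V] {E : Finset (V × V)} (hself : ∀ j : V, (j, j) ∈ E)
    (hconn : StronglyConnected E) (j : V) :
    reachingSet E j (Fintype.card V - 1) = Finset.univ := by
  rcases reachingSet_card hself hconn j (Fintype.card V - 1) with h | h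
  · exact h
  · have := Fintype.card_pos (α := V)
    exact Finset.eq_univ_of_card _ (le_antisymm (Finset.card_le_univ _) (by omega))

/-- One time step with all packets delivered. -/
noncomputable def deliver (E : Finset (V × V)) : Module.End ℝ (Mass V) :=
  transfer E fun _ _ => 1

lemma deliver_nonneg (E : Finset (V × V)) {m : Mass V} (hm : 0 ≤ m) : 0 ≤ deliver E m :=
  transfer_nonneg (fun _ _ _ => ⟨zero_le_one, le_rfl⟩) hm

lemma deliver_pow_nonneg (E : Finset (V × V)) (k : ℕ) {m : Mass V} (hm : 0 ≤ m) :
    0 ≤ (deliver E ^ k) m := by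
  induction k with
  | zero => simpa using hm
  | succ k ih => rw [pow_succ', Module.End.mul_apply]; exact deliver_nonneg E ih

lemma totalMass_deliver_pow {E : Finset (V × V)} (hself : ∀ j : V, (j, j) ∈ E) (k : ℕ)
    (m : Mass V) : totalMass E ((deliver E ^ k) m) = totalMass E m := by
  induction k with
  | zero => simp
  | succ k ih => rw [pow_succ', Module.End.mul_apply, deliver, totalMass_transfer hself]; exact ih

lemma deliver_snd (E : Finset (V × V)) (m : Mass V) : (deliver E m).2 = 0 := by
  ext e
  simp [deliver, transfer_snd]

lemma outDegree_le_maxOutDegree (E : Finset (V × V)) (j : V) : outDegree E j ≤ maxOutDegree E :=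
  Finset.le_sup (f := outDegree E) (Finset.mem_univ j)

lemma maxOutDegree_pos [Nonempty V] {E : Finset (V × V)} (hself : ∀ j : V, (j, j) ∈ E) :
    0 < maxOutDegree E :=
  (outDegree_pos hself (Classical.arbitrary V)).trans_le (outDegree_le_maxOutDegree E _)

/-- For each source node it suffices to follow one link towards `j` per step; that link carries at
least the fraction `1 / D` of the node's mass. -/
lemma sum_reachingSet_le_deliver_pow {E : Finset (V × V)} (hself : ∀ j : V, (j, j) ∈ E) (j : V)
    (k : ℕ) {m : Mass V} (hm : 0 ≤ m) :
    (∑ i ∈ reachingSet E j k, m.1 i) / (maxOutDegree E : ℝ) ^ k ≤ ((deliver E ^ k) m).1 j := by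
  induction k generalizing m with
  | zero => simp [reachingSet]
  | succ k ih =>
    rw [pow_succ (deliver E), Module.End.mul_apply]
    refine le_trans ?_ (ih (deliver_nonneg E hm))
    rw [pow_succ' (maxOutDegree E : ℝ), ← div_div]
    refine div_le_div_of_nonneg_right ?_ (by positivity)
    have hm1 : ∀ i, 0 ≤ m.1 i := fun i => hm.1 i
    have hnode : ∀ l i, (l, i) ∈ E → m.1 i / (maxOutDegree E : ℝ) ≤ pending E m (l, i) := by
      intro l i _
      have h1 : (0 : ℝ) < outDegree E i := by exact_mod_cast outDegree_pos hself i
      have h2 : (outDegree E i : ℝ) ≤ maxOutDegree E := by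
        exact_mod_cast outDegree_le_maxOutDegree E i
      have h3 : (0 : ℝ) ≤ m.2 (l, i) := hm.2 (l, i)
      have h4 := div_le_div_of_nonneg_left (hm1 i) h1 h2
      simp only [pending]
      linarith
    have hterm : ∀ l i, 0 ≤ (if (l, i) ∈ E then pending E m (l, i) * 1 else 0) := by
      intro l i
      split_ifs
      · rw [mul_one]; exact pending_nonneg E hm _
      · exact le_rfl
    -- Grouping by source `i` prevents double counting when several sources feed the same node.
    have hsum : ∑ l ∈ reachingSet E j k, (deliver E m).1 l =
        ∑ i, ∑ l ∈ reachingSet E j k, if (l, i) ∈ E then pending E m (l, i) * 1 else 0 := by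
      rw [Finset.sum_comm]; rfl
    rw [hsum, Finset.sum_div]
    refine le_trans (Finset.sum_le_sum fun i hi => ?_)
      (Finset.sum_le_sum_of_subset_of_nonneg (Finset.subset_univ (reachingSet E j (k + 1)))
        fun i _ _ => Finset.sum_nonneg fun l _ => hterm l i)
    obtain ⟨l, hl, hli⟩ := mem_reachingSet_succ.mp hi
    refine le_trans ?_ (Finset.single_le_sum (fun l _ => hterm l i) hl)
    rw [if_pos hli, mul_one]
    exact hnode l i hli

/-- After as many successful steps as there are nodes, every node holds a fixed fraction of the
total mass. -/
lemma totalMass_div_le_deliver_pow [Nonempty V] {E : Finset (V × V)}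
    (hself : ∀ j : V, (j, j) ∈ E) (hconn : StronglyConnected E) {m : Mass V} (hm : 0 ≤ m)
    (j : V) :
    totalMass E m / (maxOutDegree E : ℝ) ^ (Fintype.card V - 1) ≤
      ((deliver E ^ Fintype.card V) m).1 j := by
  have h := sum_reachingSet_le_deliver_pow hself j (Fintype.card V - 1) (deliver_nonneg E hm)
  -- After one full delivery all mass sits on the nodes; this spends one of the `n` steps and leaves
  -- the exponent `n - 1`.
  have htot : totalMass E m = ∑ i, (deliver E m).1 i := by
    rw [← totalMass_transfer hself (fun _ _ => 1) m]
    change totalMass E (deliver E m) = _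
    rw [totalMass_apply, deliver_snd]
    simp
  rw [reachingSet_eq_univ hself hconn, ← htot, ← Module.End.mul_apply, ← pow_succ,
    Nat.sub_add_cancel Fintype.card_pos] at h
  exact h

/-! ### Trajectories -/

/-- The mass distribution at time `k`, from initial node masses `u₀` and empty buffers. -/
noncomputable def trajectory (E : Finset (V × V)) (x : ℕ → V → V → ℝ) (u₀ : V → ℝ) :
    ℕ → Mass V
  | 0 => (u₀, 0)
  | k + 1 => transfer E (x k) (trajectory E x u₀ k)

/-- The buffer content is sent minus received. The clause about non-links makes their terms vanish
in the sum defining the next node value. -/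
lemma state_eq_trajectory (E : Finset (V × V)) (x : ℕ → V → V → ℝ) (u₀ : V → ℝ) (k : ℕ) :
    (state E x u₀ k).value = (trajectory E x u₀ k).1 ∧
    (∀ j i, (j, i) ∈ E → (state E x u₀ k).sent j i - (state E x u₀ k).received j i =
      (trajectory E x u₀ k).2 (j, i)) ∧
    (∀ j i, (j, i) ∉ E → (state E x u₀ k).received j i = 0) := by
  induction k with
  | zero => simp [state, trajectory]
  | succ k ih =>
    obtain ⟨h1, h2, h3⟩ := ih
    refine ⟨funext fun j => ?_, fun j i hji => ?_, fun j i hji => ?_⟩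
    · change ∑ i, (newReceived E (x k) _ j i - _) = (transfer E (x k) _).1 j
      rw [transfer_fst]
      refine Finset.sum_congr rfl fun i _ => ?_
      split_ifs with hji
      · rw [newReceived, newSent, if_pos hji, if_pos hji, pending, ← h2 j i hji, ← h1]
        ring
      · rw [newReceived, if_neg hji, h3 j i hji, sub_zero]
    · change newSent E _ j i - newReceived E (x k) _ j i = (transfer E (x k) _).2 (j, i)
      rw [transfer_snd, if_pos hji, newReceived, newSent, if_pos hji, if_pos hji, pending,
        ← h2 j i hji, ← h1]
      ring
    · change newReceived E (x k) _ j i = 0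
      rw [newReceived, if_neg hji]

lemma nodeValue_eq_trajectory (E : Finset (V × V)) (x : ℕ → V → V → ℝ) (u₀ : V → ℝ)
    (k : ℕ) (j : V) : nodeValue E x u₀ k j = (trajectory E x u₀ k).1 j :=
  congrFun (state_eq_trajectory E x u₀ k).1 j

lemma trajectory_linear (E : Finset (V × V)) (x : ℕ → V → V → ℝ) (a b : ℝ) (u v : V → ℝ) (k : ℕ) :
    trajectory E x (a • u - b • v) k = a • trajectory E x u k - b • trajectory E x v k := by
  induction k with
  | zero => simp [trajectory]
  | succ k ih => simp only [trajectory, ih, map_sub, map_smul]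

lemma totalMass_trajectory {E : Finset (V × V)} (hself : ∀ j : V, (j, j) ∈ E)
    (x : ℕ → V → V → ℝ) (u₀ : V → ℝ) (k : ℕ) :
    totalMass E (trajectory E x u₀ k) = ∑ i, u₀ i := by
  induction k with
  | zero => simp [trajectory, totalMass_apply]
  | succ k ih => rw [trajectory, totalMass_transfer hself, ih]

lemma trajectory_nonneg {E : Finset (V × V)} {x : ℕ → V → V → ℝ}
    (hx : ∀ k j i, (j, i) ∈ E → 0 ≤ x k j i ∧ x k j i ≤ 1) {u₀ : V → ℝ} (hu : 0 ≤ u₀) (k : ℕ) :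
    0 ≤ trajectory E x u₀ k := by
  induction k with
  | zero => exact ⟨hu, le_rfl⟩
  | succ k ih => exact transfer_nonneg (hx k) ih

lemma trajectory_add_of_delivered {E : Finset (V × V)} {x : ℕ → V → V → ℝ} (u₀ : V → ℝ) {k l : ℕ}
    (h : ∀ s < l, ∀ j i, (j, i) ∈ E → x (k + s) j i = 1) :
    trajectory E x u₀ (k + l) = (deliver E ^ l) (trajectory E x u₀ k) := by
  induction l with
  | zero => simp
  | succ l ih =>
    rw [pow_succ', Module.End.mul_apply, ← ih fun s hs => h s (hs.trans l.lt_succ_self),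
      ← add_assoc, trajectory, deliver, transfer_congr (h l l.lt_succ_self)]

/-- The limit `L` exists by monotonicity, and the recurring inequality passes to it as `L ≤ ρ * L`.
The contracting windows may therefore overlap. -/
lemma tendsto_zero_of_frequently_contracted {f : ℕ → ℝ} (hf : Antitone f) (h0 : ∀ k, 0 ≤ f k)
    {ρ : ℝ} (hρ : ρ < 1) {n : ℕ} (h : ∃ᶠ k in atTop, f (k + n) ≤ ρ * f k) :
    Tendsto f atTop (𝓝 0) := by
  have hbdd : BddBelow (Set.range f) := ⟨0, by rintro _ ⟨k, rfl⟩; exact h0 k⟩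
  have hlim := tendsto_atTop_ciInf hf hbdd
  set L := ⨅ k, f k
  have hL0 : 0 ≤ L := le_ciInf h0
  have hsub : Tendsto (fun k => ρ * f k - f (k + n)) atTop (𝓝 (ρ * L - L)) :=
    (hlim.const_mul ρ).sub ((tendsto_add_atTop_iff_nat n).mpr hlim)
  have hL : 0 ≤ ρ * L - L :=
    isClosed_Ici.mem_of_frequently_of_tendsto (h.mono fun k hk => sub_nonneg.mpr hk) hsub
  have : L = 0 := by nlinarith
  rwa [this] at hlim

/-- Every transmission at the times `k, …, k + n - 1` is successful, `n` the number of nodes. -/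
def DeliveredBlock (E : Finset (V × V)) (x : ℕ → V → V → ℝ) (k : ℕ) : Prop :=
  ∀ s < Fintype.card V, ∀ j i, (j, i) ∈ E → x (k + s) j i = 1

/-! ### Convergence for fixed link indicators with infinitely many delivered blocks -/

section Deterministic

variable [Nonempty V] {E : Finset (V × V)} {x : ℕ → V → V → ℝ}

lemma tendsto_totalMass_abs_trajectory (hself : ∀ j : V, (j, j) ∈ E)
    (hconn : StronglyConnected E) (hx : ∀ k j i, (j, i) ∈ E → 0 ≤ x k j i ∧ x k j i ≤ 1)
    (hblock : ∃ᶠ k in atTop, DeliveredBlock E x k) {u : V → ℝ} (hu : ∑ i, u i = 0) :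
    Tendsto (fun k => totalMass E |trajectory E x u k|) atTop (𝓝 0) := by
  have hD : (0 : ℝ) < maxOutDegree E := by exact_mod_cast maxOutDegree_pos hself
  refine tendsto_zero_of_frequently_contracted (n := Fintype.card V)
    (ρ := 1 - 1 / (maxOutDegree E : ℝ) ^ (Fintype.card V - 1))
    (antitone_nat_of_succ_le fun k => totalMass_abs_transfer_le hself (hx k) _)
    (fun k => totalMass_nonneg E (abs_nonneg _)) (sub_lt_self _ (by positivity)) ?_
  refine hblock.mono fun k hk => ?_
  rw [trajectory_add_of_delivered u hk]
  -- One common receiving node is enough for contraction, so any choice serves.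
  refine totalMass_abs_map_le (j := Classical.arbitrary V) (fun m hm => deliver_pow_nonneg E _ hm)
    (totalMass_deliver_pow hself _) (fun m hm => ?_) (by rw [totalMass_trajectory hself, hu])
  rw [one_div_mul_eq_div]
  exact totalMass_div_le_deliver_pow hself hconn hm _

lemma tendsto_ratio (hself : ∀ j : V, (j, j) ∈ E)
    (hconn : StronglyConnected E) (hx : ∀ k j i, (j, i) ∈ E → 0 ≤ x k j i ∧ x k j i ≤ 1)
    (hblock : ∃ᶠ k in atTop, DeliveredBlock E x k) (y₀ : V → ℝ) {z₀ : V → ℝ}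
    (hz₀ : ∀ j, 0 < z₀ j) (j : V) {c : ℝ} (hc : 0 < c) {t : ℕ → ℕ} (ht : StrictMono t)
    (htc : ∀ r, c < nodeValue E x z₀ (t r) j) :
    Tendsto (fun r => nodeValue E x y₀ (t r) j / nodeValue E x z₀ (t r) j) atTop
      (𝓝 ((∑ i, y₀ i) / (∑ i, z₀ i))) := by
  set Y := ∑ i, y₀ i
  set Z := ∑ i, z₀ i
  have hZ : 0 < Z := Finset.sum_pos (fun i _ => hz₀ i) Finset.univ_nonempty
  have hd : ∑ i, (Z • y₀ - Y • z₀) i = 0 := by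
    simp only [Pi.sub_apply, Pi.smul_apply, smul_eq_mul, Finset.sum_sub_distrib, ← Finset.mul_sum]
    change Z * Y - Y * Z = 0
    ring
  have hlim := ((tendsto_totalMass_abs_trajectory hself hconn hx hblock hd).comp
    ht.tendsto_atTop).div_const (c * Z)
  rw [zero_div] at hlim
  rw [tendsto_iff_norm_sub_tendsto_zero]
  refine squeeze_zero (fun r => norm_nonneg _) (fun r => ?_) hlim
  have hz := htc r
  have hzpos := hc.trans hz
  have hle := abs_fst_le_totalMass E (trajectory E x (Z • y₀ - Y • z₀) (t r)) j
  have hval : (trajectory E x (Z • y₀ - Y • z₀) (t r)).1 j =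
      Z * nodeValue E x y₀ (t r) j - Y * nodeValue E x z₀ (t r) j := by
    rw [trajectory_linear, nodeValue_eq_trajectory, nodeValue_eq_trajectory]
    rfl
  rw [hval] at hle
  -- `y / z - Y / Z = (y * Z - z * Y) / (z * Z)`, with denominator at least `c * Z`.
  rw [Real.norm_eq_abs, div_sub_div _ _ hzpos.ne' hZ.ne', abs_div, abs_of_pos (mul_pos hzpos hZ)]
  refine div_le_div₀ (totalMass_nonneg E (abs_nonneg _)) ?_ (mul_pos hc hZ)
    (mul_le_mul_of_nonneg_right hz.le hZ.le)
  refine le_trans (le_of_eq ?_) hle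
  congr 1; ring

lemma massConstant_pos (hself : ∀ j : V, (j, j) ∈ E) : 0 < massConstant E := by
  have hD : (0 : ℝ) < maxOutDegree E := by exact_mod_cast maxOutDegree_pos hself
  have hn : (0 : ℝ) < Fintype.card V := by exact_mod_cast Fintype.card_pos
  unfold massConstant
  positivity

lemma infinite_massConstant_lt (hself : ∀ j : V, (j, j) ∈ E)
    (hconn : StronglyConnected E) (hx : ∀ k j i, (j, i) ∈ E → 0 ≤ x k j i ∧ x k j i ≤ 1)
    (hblock : ∃ᶠ k in atTop, DeliveredBlock E x k) {z₀ : V → ℝ} (hz₀ : ∀ j, 0 < z₀ j) (j : V) :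
    {k : ℕ | (∑ i, z₀ i) / (Fintype.card V : ℝ) * massConstant E
      < nodeValue E x z₀ k j}.Infinite := by
  have hD : (0 : ℝ) < maxOutDegree E := by exact_mod_cast maxOutDegree_pos hself
  have hn : (1 : ℝ) ≤ Fintype.card V := by exact_mod_cast Fintype.card_pos
  have hm : (1 : ℝ) ≤ E.card := by
    exact_mod_cast Finset.card_pos.mpr ⟨_, hself (Classical.arbitrary V)⟩
  have hZ : 0 < ∑ i, z₀ i := Finset.sum_pos (fun i _ => hz₀ i) Finset.univ_nonempty
  -- The strict inequality has the factor `n + m > 1` to spare.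
  have hlt : (∑ i, z₀ i) / (Fintype.card V : ℝ) * massConstant E <
      (∑ i, z₀ i) / (maxOutDegree E : ℝ) ^ (Fintype.card V - 1) := by
    have heq : (∑ i, z₀ i) / (Fintype.card V : ℝ) * massConstant E =
        (∑ i, z₀ i) / (maxOutDegree E : ℝ) ^ (Fintype.card V - 1) /
          ((Fintype.card V : ℝ) + E.card) := by
      unfold massConstant
      field_simp
    rw [heq]
    exact div_lt_self (by positivity) (by linarith)
  rw [← Nat.frequently_atTop_iff_infinite]
  have hf : ∃ᶠ k in atTop, (∑ i, z₀ i) / (Fintype.card V : ℝ) * massConstant E <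
      nodeValue E x z₀ (k + Fintype.card V) j := by
    refine hblock.mono fun k hk => hlt.trans_le ?_
    have h := totalMass_div_le_deliver_pow hself hconn
      (trajectory_nonneg hx (fun i => (hz₀ i).le) k) j
    rwa [totalMass_trajectory hself, ← trajectory_add_of_delivered z₀ hk,
      ← nodeValue_eq_trajectory] at h
  exact (tendsto_add_atTop_nat (Fintype.card V)).frequently hf

end Deterministic

/-! ### Successful blocks occur infinitely often -/

section Random

variable {E : Finset (V × V)} {Ω : Type*} [MeasurableSpace Ω] {μ : Measure Ω}
  [IsProbabilityMeasure μ] {q : ℝ} {x : ℕ → V → V → Ω → ℝ}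

/-- The values `1` and `0` exhaust the probability. The bounds are what makes the transfer maps
positive. -/
lemma ae_mem_unitInterval
    (hx_meas : ∀ k j i, (j, i) ∈ E → Measurable (x k j i))
    (hx_one : ∀ k j i, (j, i) ∈ E → μ.real {ω | x k j i ω = 1} = q)
    (hx_zero : ∀ k j i, (j, i) ∈ E → μ.real {ω | x k j i ω = 0} = 1 - q) :
    ∀ᵐ ω ∂μ, ∀ k j i, (j, i) ∈ E → 0 ≤ x k j i ω ∧ x k j i ω ≤ 1 := by
  simp only [ae_all_iff]
  intro k j i h
  have h1 : MeasurableSet {ω | x k j i ω = 1} := hx_meas k j i h (measurableSet_singleton 1)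
  have h0 : MeasurableSet {ω | x k j i ω = 0} := hx_meas k j i h (measurableSet_singleton 0)
  have hdisj : Disjoint {ω | x k j i ω = 1} {ω | x k j i ω = 0} :=
    Set.disjoint_left.mpr fun ω (h : x k j i ω = 1) (h' : x k j i ω = 0) => by
      rw [h] at h'; exact one_ne_zero h'
  have hu : μ.real ({ω | x k j i ω = 1} ∪ {ω | x k j i ω = 0}) = 1 := by
    rw [measureReal_union hdisj h0, hx_one k j i h, hx_zero k j i h]; ring
  have hu' : μ ({ω | x k j i ω = 1} ∪ {ω | x k j i ω = 0}) = 1 := by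
    rw [← ofReal_measureReal, hu, ENNReal.ofReal_one]
  filter_upwards [(mem_ae_iff_prob_eq_one (h1.union h0)).mpr hu'] with ω hω
  rcases hω with hω | hω
  · rw [Set.mem_ofPred_eq.mp hω]; norm_num
  · rw [Set.mem_ofPred_eq.mp hω]; norm_num

/-- The index set of the transmissions of the `r`-th block. -/
def blockIndex (E : Finset (V × V)) (r : ℕ) : Finset (ℕ × {e : V × V // e ∈ E}) :=
  Finset.Ico (Fintype.card V * r) (Fintype.card V * r + Fintype.card V) ×ˢ Finset.univ

lemma pairwise_disjoint_blockIndex (E : Finset (V × V)) :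
    Pairwise fun r s => Disjoint (blockIndex E r) (blockIndex E s) := by
  have key : ∀ r s : ℕ, r < s → Disjoint (blockIndex E r) (blockIndex E s) := by
    intro r s hrs
    rw [Finset.disjoint_left]
    intro p hp hp'
    simp only [blockIndex, Finset.mem_product, Finset.mem_Ico, Finset.mem_univ, and_true] at hp hp'
    have : Fintype.card V * (r + 1) ≤ Fintype.card V * s := Nat.mul_le_mul_left _ hrs
    rw [mul_add, mul_one] at this
    omega
  intro r s hrs
  rcases hrs.lt_or_gt with h | h
  · exact key r s h
  · exact (key s r h).symm

lemma ae_frequently_deliveredBlock [Nonempty V] (hq_pos : 0 < q)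
    (hx_meas : ∀ k j i, (j, i) ∈ E → Measurable (x k j i))
    (hx_one : ∀ k j i, (j, i) ∈ E → μ.real {ω | x k j i ω = 1} = q)
    (hx_indep : iIndepFun
      (fun (p : ℕ × {e : V × V // e ∈ E}) => x p.1 p.2.1.1 p.2.1.2) μ) :
    ∀ᵐ ω ∂μ, ∃ᶠ k in atTop, DeliveredBlock E (fun k j i => x k j i ω) k := by
  classical
  set S : ℕ × {e : V × V // e ∈ E} → Set Ω := fun p => {ω | x p.1 p.2.1.1 p.2.1.2 ω = 1} with hS
  set A : ℕ → Set Ω := fun r => ⋂ p ∈ blockIndex E r, S p with hA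
  have hSmeas : ∀ p, MeasurableSet (S p) := fun p =>
    hx_meas p.1 p.2.1.1 p.2.1.2 p.2.2 (measurableSet_singleton 1)
  have hSprob : ∀ p, μ (S p) = ENNReal.ofReal q := fun p => by
    rw [← hx_one p.1 p.2.1.1 p.2.1.2 p.2.2, ofReal_measureReal]
  have hInter : ∀ s : Finset (ℕ × {e : V × V // e ∈ E}),
      μ (⋂ p ∈ s, S p) = ∏ p ∈ s, μ (S p) := fun s =>
    hx_indep.measure_inter_preimage_eq_mul s (sets := fun _ => {1})
      fun _ _ => measurableSet_singleton 1
  have hAmeas : ∀ r, MeasurableSet (A r) := fun r =>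
    Finset.measurableSet_biInter _ fun p _ => hSmeas p
  have hAindep : iIndepSet A μ := by
    -- Blocks use disjoint sets of transmissions, so an intersection of block events is one finite
    -- intersection of independent events and factors.
    rw [iIndepSet_iff_meas_biInter hAmeas]
    intro s
    have h : ⋂ r ∈ s, A r = ⋂ p ∈ s.biUnion (blockIndex E), S p := by
      simp only [hA]
      rw [Finset.set_biInter_biUnion]
    rw [h, hInter, Finset.prod_biUnion fun a _ b _ hab => pairwise_disjoint_blockIndex E hab]
    exact Finset.prod_congr rfl fun r _ => (hInter _).symm
  have hAprob : ∀ r, μ (A r) = ENNReal.ofReal q ^ (Fintype.card V * E.card) := fun r => by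
    rw [hInter, Finset.prod_congr rfl fun p _ => hSprob p, Finset.prod_const]
    congr 1
    simp [blockIndex]
  have hsum : ∑' r, μ (A r) = ⊤ := by
    simp only [hAprob]
    refine ENNReal.tsum_const_eq_top_of_ne_zero (pow_ne_zero _ ?_)
    simpa using hq_pos
  have hlim := measure_limsup_eq_one hAmeas hAindep hsum
  filter_upwards [(mem_ae_iff_prob_eq_one (MeasurableSet.measurableSet_limsup hAmeas)).mpr hlim]
    with ω hω
  rw [mem_limsup_iff_frequently_mem] at hω
  -- Block `r` starts at time `n * r`, so infinitely many `r` give arbitrarily late starting times.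
  have htend : Tendsto (fun r : ℕ => Fintype.card V * r) atTop atTop :=
    tendsto_id.const_mul_atTop' Fintype.card_pos
  refine htend.frequently (hω.mono fun r hr => ?_)
  intro s hs j i hji
  simp only [hA, Set.mem_iInter] at hr
  exact hr (Fintype.card V * r + s, ⟨(j, i), hji⟩)
    (by simp only [blockIndex, Finset.mem_product, Finset.mem_Ico, Finset.mem_univ, and_true]; omega)

end Random

end RatioConsensus

theorem mainTheorem5
    {V : Type*} [Fintype V] [DecidableEq V] [Nonempty V]
    (E : Finset (V × V))
    (hself : ∀ j : V, (j, j) ∈ E)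
    (hconn : RatioConsensus.StronglyConnected E)
    {Ω : Type*} [MeasurableSpace Ω] (μ : Measure Ω) [IsProbabilityMeasure μ]
    (q : ℝ) (hq_pos : 0 < q) (hq_le : q ≤ 1)
    (x : ℕ → V → V → Ω → ℝ)
    (hx_meas : ∀ k j i, (j, i) ∈ E → Measurable (x k j i))
    (hx_one : ∀ k j i, (j, i) ∈ E → μ.real {ω | x k j i ω = 1} = q)
    (hx_zero : ∀ k j i, (j, i) ∈ E → μ.real {ω | x k j i ω = 0} = 1 - q)
    (hx_indep : iIndepFun
      (fun (p : ℕ × {e : V × V // e ∈ E}) => x p.1 p.2.1.1 p.2.1.2) μ)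
    (y₀ z₀ : V → ℝ) (hz₀ : ∀ j, 0 < z₀ j)
    (y z : ℕ → V → Ω → ℝ)
    (hy : ∀ k j ω, y k j ω = RatioConsensus.nodeValue E (fun k j i => x k j i ω) y₀ k j)
    (hz : ∀ k j ω, z k j ω = RatioConsensus.nodeValue E (fun k j i => x k j i ω) z₀ k j) :
    -- convergence of the ratio along all time steps at which `z` exceeds a positive threshold
    (∀ᵐ ω ∂μ, ∀ j : V, ∀ c : ℝ, 0 < c → ∀ t : ℕ → ℕ, StrictMono t →
      (∀ r, c < z (t r) j ω) →
      Tendsto (fun r => y (t r) j ω / z (t r) j ω) atTop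
        (𝓝 ((∑ i, y₀ i) / (∑ i, z₀ i)))) ∧
    -- such time steps exist, infinitely many of them
    (∀ᵐ ω ∂μ, ∀ j : V,
      {k : ℕ | (∑ i, z₀ i) / (Fintype.card V : ℝ) * RatioConsensus.massConstant E
        < z k j ω}.Infinite) ∧
    -- average consensus
    ((∀ j, z₀ j = 1) →
      ∀ᵐ ω ∂μ, ∀ j : V,
        {k : ℕ | RatioConsensus.massConstant E < z k j ω}.Infinite ∧
        ∀ t : ℕ → ℕ, StrictMono t → (∀ r, RatioConsensus.massConstant E < z (t r) j ω) →
          Tendsto (fun r => y (t r) j ω / z (t r) j ω) atTop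
            (𝓝 ((∑ i, y₀ i) / (Fintype.card V : ℝ)))) := by
  -- A single almost sure event, independent of `j`, `c` and `t`, so these may be quantified inside.
  have hgood : ∀ᵐ ω ∂μ, (∀ k j i, (j, i) ∈ E → 0 ≤ x k j i ω ∧ x k j i ω ≤ 1) ∧
      ∃ᶠ k in atTop, RatioConsensus.DeliveredBlock E (fun k j i => x k j i ω) k :=
    (RatioConsensus.ae_mem_unitInterval hx_meas hx_one hx_zero).and
      (RatioConsensus.ae_frequently_deliveredBlock hq_pos hx_meas hx_one hx_indep)
  have h1 : ∀ᵐ ω ∂μ, ∀ j : V, ∀ c : ℝ, 0 < c → ∀ t : ℕ → ℕ, StrictMono t →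
      (∀ r, c < z (t r) j ω) →
      Tendsto (fun r => y (t r) j ω / z (t r) j ω) atTop
        (𝓝 ((∑ i, y₀ i) / (∑ i, z₀ i))) := by
    filter_upwards [hgood] with ω hω j c hc t ht htc
    simp only [hz] at htc
    simp only [hy, hz]
    exact RatioConsensus.tendsto_ratio hself hconn hω.1 hω.2 y₀ hz₀ j hc ht htc
  have h2 : ∀ᵐ ω ∂μ, ∀ j : V,
      {k : ℕ | (∑ i, z₀ i) / (Fintype.card V : ℝ) * RatioConsensus.massConstant E
        < z k j ω}.Infinite := by
    filter_upwards [hgood] with ω hω j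
    simp only [hz]
    exact RatioConsensus.infinite_massConstant_lt hself hconn hω.1 hω.2 hz₀ j
  refine ⟨h1, h2, fun hone => ?_⟩
  -- With unit initial masses the factor `Z / n` in the threshold equals `1`.
  have hsum : ∑ i, z₀ i = (Fintype.card V : ℝ) := by simp [hone]
  have hn : (Fintype.card V : ℝ) ≠ 0 := by exact_mod_cast Fintype.card_ne_zero
  filter_upwards [h1, h2] with ω hω1 hω2 j
  refine ⟨?_, fun t ht htc => ?_⟩
  · have h := hω2 j
    rwa [hsum, div_self hn, one_mul] at h
  · have h := hω1 j _ (RatioConsensus.massConstant_pos hself) t ht htc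
    rwa [hsum] at h
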